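/- Let $\mathbb{D}=\{z\in\mathbb{C}:|z|<1\}$. For $0<\lambda\le 1$ let $\mathcal{U}_2(\lambda)$ be the class of all functions $f$ analytic in $\mathbb{D}$ with $f(0)=0$, $f'(0)=1$, $f''(0)=0$ and $$\left|\left(\frac{z}{f(z)}\right)^{2}f'(z)-1\right|<\lambda\quad\text{for all } z\in\mathbb{D}$$ (where $z/f(z)$ is given the value $1$ at $z=0$). Suppose that $0<\lambda\le\sqrt2-1$, that $H\in\mathcal{U}_2(\lambda)$, that $G$ is analytic in $\mathbb{D}$, and that the dilatation $\omega=G'/H'$ of $F=H+\overline{G}$ satisfies $\omega(0)=0$ and $$|\omega(z)|\le\frac{1-2\lambda-\lambda^2}{(1+\lambda)^2}\quad\text{for all } z\in\mathbb{D}.$$ Then $F$ is harmonic in $\mathbb{D}$, sense-preserving (its Jacobian is positive at every point of $\mathbb{D}$) and close-to-convex. The latter means that $F$ is univalent (injective) in $\mathbb{D}$ and that the complement $D=\mathbb{C}\setminus F(\mathbb{D})$ can be filled with non-intersecting half-lines: $D$ is a union of closed half-lines whose initial points lie on $\partial D$ and which are pairwise disjoint once their initial points are removed. -/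

import Mathlib

open Complex Metric Set
open scoped ComplexConjugate

noncomputable section

namespace HarmonicUnivalent

/-- The open unit disk of the complex plane. -/
def disk : Set ℂ := ball 0 1

/-- The class `𝒜`: functions analytic in the unit disk with `f 0 = 0` and `f' 0 = 1`. -/
def ClassA : Set (ℂ → ℂ) :=
  {f | AnalyticOnNhd ℂ f disk ∧ f 0 = 0 ∧ deriv f 0 = 1}

/-- The function `z / f z`, with its removable singularity at `0` filled in
(the value is `1 / f' 0 = 1` for `f` in the class `𝒜`). -/
def zDiv (f : ℂ → ℂ) (z : ℂ) : ℂ := if z = 0 then 1 else z / f z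

/-- `U_f z = (z / f z) ^ 2 * f' z - 1`. If `f` vanishes at some `z ≠ 0`, the convention
`z / 0 = 0` gives `U_f z = -1`, so that such an `f` lies in no class `ClassU lam` with
`lam ≤ 1`. -/
def opU (f : ℂ → ℂ) (z : ℂ) : ℂ := zDiv f z ^ 2 * deriv f z - 1

/-- The class `𝒰(λ)`, for `0 < λ ≤ 1`. -/
def ClassU (lam : ℝ) : Set (ℂ → ℂ) :=
  {f | f ∈ ClassA ∧ ∀ z ∈ disk, ‖opU f z‖ < lam}

/-- The class `𝒰₂(λ)`: members of `𝒰(λ)` with `f'' 0 = 0`. -/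
def ClassU₂ (lam : ℝ) : Set (ℂ → ℂ) :=
  {f | f ∈ ClassU lam ∧ iteratedDeriv 2 f 0 = 0}

/-- The function `F = H + conj G`. -/
def harmonicSum (H G : ℂ → ℂ) (z : ℂ) : ℂ := H z + conj (G z)

/-- The dilatation `ω = G' / H'` of `F = H + conj G`. -/
def dilatation (H G : ℂ → ℂ) (z : ℂ) : ℂ := deriv G z / deriv H z

/-- A complex-valued function is harmonic in the disk if its real and imaginary parts are. -/
def IsHarmonicInDisk (F : ℂ → ℂ) : Prop :=
  InnerProductSpace.HarmonicOnNhd (fun z => (F z).re) disk ∧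
    InnerProductSpace.HarmonicOnNhd (fun z => (F z).im) disk

/-- Sense-preserving (and locally univalent): `F` is real differentiable and its Jacobian
determinant, as a map of the real plane, is positive at every point of the disk. -/
def IsSensePreserving (F : ℂ → ℂ) : Prop :=
  ∀ z ∈ disk, DifferentiableAt ℝ F z ∧ 0 < (fderiv ℝ F z).det

/-- The closed half-line emanating from `p.1` in the direction `p.2`. -/
def closedHalfLine (p : ℂ × ℂ) : Set ℂ := {w | ∃ t : ℝ, 0 ≤ t ∧ w = p.1 + t * p.2}

/-- The half-line emanating from `p.1` in the direction `p.2`, without its initial point. -/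
def openHalfLine (p : ℂ × ℂ) : Set ℂ := {w | ∃ t : ℝ, 0 < t ∧ w = p.1 + t * p.2}

/-- The set `D` can be filled with non-intersecting half-lines that emanate on the boundary of
`D` and lie completely in `D`. As usual, the initial point of one half-line may lie on another
one: it is the half-lines without their initial points that are pairwise disjoint. A half-line
is given by its initial point and its unit direction, so different pairs are different
half-lines. -/
def FilledByHalfLines (D : Set ℂ) : Prop :=
  ∃ S : Set (ℂ × ℂ),
    (∀ p ∈ S, ‖p.2‖ = 1 ∧ p.1 ∈ frontier D) ∧
    S.PairwiseDisjoint openHalfLine ∧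
    ⋃ p ∈ S, closedHalfLine p = D

/-- A close-to-convex harmonic mapping of the disk: harmonic and univalent in the disk, such that
the complement of its image can be filled with non-intersecting half-lines. -/
structure IsCloseToConvexHarmonic (F : ℂ → ℂ) : Prop where
  harmonic : IsHarmonicInDisk F
  univalent : InjOn F disk
  filled : FilledByHalfLines (F '' disk)ᶜ

end HarmonicUnivalent

end

/-!
The key to the theorem is that `F = H + conj G` is a strongly monotone map of the disk.

*Strong monotonicity.* For `H ∈ 𝒰₂(λ)` put `p = z / H`. Then `H' = (1 + U_H) / p ^ 2` with
`|U_H| < λ`, and `|p - 1| ≤ λ` (`norm_zDiv_sub_one_le`) because `((p - 1) / z)' = - U_H / z ^ 2` is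
bounded by `λ` and `p - 1` vanishes to second order at the origin. So `|arg H'| ≤ 3 arcsin λ`,
which gives `re H' ≥ (1 - 5 λ ^ 2 + 2 λ ^ 4) |H'|` (`le_re_div_sq`). The factor exceeds the bound on
the dilatation (`dilatation_bound_lt`), and `|H'|` is bounded above and away from zero, so
`re H' - |G'|` has a positive lower bound. The Jacobian `|H'| ^ 2 - |G'| ^ 2` is therefore positive,
and `id - τ F` is a contraction of the disk for small `τ > 0` (`exists_contraction_harmonicSum`).

*Filling the complement.* A map `F` with this property extends to a Lipschitz map of the closed
disk. The variational inequality for `F - w` on the closed disk, which asks for a point `a` such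
that `w - F a` is an outward normal vector at `a`, is a fixed point equation for a contraction, so it
has exactly one solution for each `w` (`existsUnique_mem_normalRay`). The solution is an interior
point exactly when `w` is in the image of the open disk; otherwise `w` lies on the ray from `F a`
in the direction `a`, where `|a| = 1`. Uniqueness gives injectivity of `F` and disjointness of the
rays, existence shows that the rays fill the complement (`injOn_and_filled_of_contraction`).
-/

open Complex Metric Set
open scoped ComplexConjugate

namespace HarmonicUnivalent

/-! ### Strongly monotone maps of the disk -/

/-- The nearest-point projection of the plane onto the closed unit disk. -/
noncomputable def diskProj (y : ℂ) : ℂ := ((max 1 ‖y‖)⁻¹ : ℝ) • y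

lemma norm_diskProj_le_one (y : ℂ) : ‖diskProj y‖ ≤ 1 := by
  have h : (0 : ℝ) < max 1 ‖y‖ := lt_max_of_lt_left one_pos
  rw [diskProj, norm_smul, norm_inv, Real.norm_of_nonneg h.le, inv_mul_le_iff₀ h, mul_one]
  exact le_max_right _ _

/-- Every point is its projection plus an outward normal vector there; the scalar `t` vanishes
unless the projection lies on the unit circle. -/
lemma exists_eq_smul_diskProj (y : ℂ) :
    ∃ t : ℝ, 0 ≤ t ∧ y = (1 + t) • diskProj y ∧ (t = 0 ∨ ‖diskProj y‖ = 1) := by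
  have h : (0 : ℝ) < max 1 ‖y‖ := lt_max_of_lt_left one_pos
  refine ⟨max 1 ‖y‖ - 1, sub_nonneg.2 (le_max_left _ _), ?_, ?_⟩
  · rw [diskProj, smul_smul, add_sub_cancel, mul_inv_cancel₀ h.ne', one_smul]
  · rcases le_total ‖y‖ 1 with hy | hy
    · exact Or.inl (by simp [hy])
    · refine Or.inr ?_
      rw [diskProj, norm_smul, norm_inv, Real.norm_of_nonneg h.le, max_eq_right hy,
        inv_mul_cancel₀ (by positivity)]

/-- A point of the closed disk is the projection of each point on its outward normal ray. -/
lemma diskProj_smul {a : ℂ} {t : ℝ} (ha : ‖a‖ ≤ 1) (ht : 0 ≤ t) (h : t = 0 ∨ ‖a‖ = 1) :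
    diskProj ((1 + t) • a) = a := by
  have h1 : (0 : ℝ) ≤ 1 + t := by linarith
  rw [diskProj, norm_smul, Real.norm_of_nonneg h1, smul_smul]
  rcases h with rfl | h
  · simp [ha]
  · rw [h, mul_one, max_eq_right (by linarith), inv_mul_cancel₀ (by positivity), one_smul]

lemma norm_diskProj_sub_le (x y : ℂ) : ‖diskProj x - diskProj y‖ ≤ ‖x - y‖ := by
  obtain ⟨s, hs, hx, hs'⟩ := exists_eq_smul_diskProj x
  obtain ⟨t, ht, hy, ht'⟩ := exists_eq_smul_diskProj y
  have hx1 := norm_diskProj_le_one x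
  have hy1 := norm_diskProj_le_one y
  generalize diskProj x = a at *
  generalize diskProj y = b at *
  subst hx hy
  have hab : inner ℝ a b ≤ ‖a‖ * ‖b‖ := real_inner_le_norm a b
  -- the normal vectors `s • a` and `t • b` do not decrease the distance
  have h1 : 0 ≤ s * (‖a‖ ^ 2 - inner ℝ a b) := by
    rcases hs' with rfl | h
    · simp
    · refine mul_nonneg hs ?_
      rw [h] at hab ⊢
      linarith
  have h2 : 0 ≤ t * (‖b‖ ^ 2 - inner ℝ a b) := by
    rcases ht' with rfl | h
    · simp
    · refine mul_nonneg ht ?_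
      rw [h] at hab ⊢
      linarith
  have h3 : (1 + s) • a - (1 + t) • b = (a - b) + (s • a - t • b) := by module
  rw [h3]
  refine le_of_sq_le_sq ?_ (norm_nonneg _)
  rw [norm_add_sq_real (a - b)]
  have h4 : inner ℝ (a - b) (s • a - t • b)
      = s * (‖a‖ ^ 2 - inner ℝ a b) + t * (‖b‖ ^ 2 - inner ℝ a b) := by
    simp only [inner_sub_left, inner_sub_right, inner_smul_right, real_inner_self_eq_norm_sq,
      real_inner_comm a b]
    rw [real_inner_comm b a]
    ring
  rw [h4]
  nlinarith [sq_nonneg ‖s • a - t • b‖]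

lemma closure_disk : closure disk = closedBall 0 1 := closure_ball _ one_ne_zero

/-- If `E = id - τ F` is a contraction on the closed disk, then each `w` lies on exactly one of the
outward normal rays `F a + t a` carried by the points `a` of the closed disk (with `t = 0` for
interior points). This is existence and uniqueness for the variational inequality of `F - w` on the
disk: the points `a` sought are the fixed points of `a ↦ diskProj (a - τ (F a - w))`. -/
lemma existsUnique_mem_normalRay {F : ℂ → ℂ} {τ : ℝ} {κ : NNReal} (hτ : 0 < τ) (hκ : κ < 1)
    (hE : LipschitzOnWith κ (fun z => z - τ • F z) (closedBall 0 1)) (w : ℂ) :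
    ∃! p : ℂ × ℝ, ‖p.1‖ ≤ 1 ∧ 0 ≤ p.2 ∧ (p.2 = 0 ∨ ‖p.1‖ = 1) ∧ w = F p.1 + p.2 • p.1 := by
  set T : ℂ → ℂ := fun a => diskProj (a - τ • F a + τ • w)
  have hT : LipschitzOnWith κ T (closedBall 0 1) := by
    refine LipschitzOnWith.of_dist_le_mul fun a ha b hb => ?_
    rw [dist_eq_norm]
    refine (norm_diskProj_sub_le _ _).trans ?_
    rw [add_sub_add_right_eq_sub, ← dist_eq_norm]
    exact hE.dist_le_mul a ha b hb
  have hmaps : MapsTo T (closedBall 0 1) (closedBall 0 1) := fun a _ => by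
    simpa using norm_diskProj_le_one _
  have hfix : ∀ p : ℂ × ℝ, ‖p.1‖ ≤ 1 → 0 ≤ p.2 → (p.2 = 0 ∨ ‖p.1‖ = 1) →
      w = F p.1 + p.2 • p.1 → T p.1 = p.1 := by
    rintro ⟨a, t⟩ h1 h2 h3 h4
    have h5 : a - τ • F a + τ • w = (1 + τ * t) • a := by
      simp only at h4
      rw [h4]; module
    change diskProj _ = _
    simp only at h1 h2 h3
    rw [h5]
    exact diskProj_smul h1 (by positivity) (h3.imp (by rintro rfl; simp) id)
  have huniq : ∀ a b : ℂ, ‖a‖ ≤ 1 → ‖b‖ ≤ 1 → T a = a → T b = b → a = b := by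
    intro a b ha hb hTa hTb
    have h := hT.dist_le_mul a (by simpa using ha) b (by simpa using hb)
    rw [hTa, hTb] at h
    have hκ' : (κ : ℝ) < 1 := by exact_mod_cast hκ
    exact dist_le_zero.1 (by nlinarith [dist_nonneg (x := a) (y := b)])
  obtain ⟨a, ha, hTa, -⟩ := ContractingWith.exists_fixedPoint' (K := κ) (f := T)
    (isCompact_closedBall (0 : ℂ) 1).isComplete hmaps
    ⟨hκ, hT.mapsToRestrict hmaps⟩ (x := 0) (by simp) (edist_ne_top _ _)
  obtain ⟨t, ht, hy, ht'⟩ := exists_eq_smul_diskProj (a - τ • F a + τ • w)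
  change _ = (1 + t) • T a at hy
  change _ ∨ ‖T a‖ = 1 at ht'
  rw [hTa.eq] at hy ht'
  have ha1 : ‖a‖ ≤ 1 := by simpa using ha
  refine ⟨(a, τ⁻¹ * t), ⟨ha1, by positivity, ht'.imp (by rintro rfl; simp) id, ?_⟩, ?_⟩
  · have h : τ • w = τ • F a + t • a := by
      have h' : τ • w = (a - τ • F a + τ • w) - a + τ • F a := by module
      rw [h', hy]; module
    calc w = τ⁻¹ • τ • w := by rw [smul_smul, inv_mul_cancel₀ hτ.ne', one_smul]
      _ = _ := by
        rw [h, smul_add, smul_smul, smul_smul, inv_mul_cancel₀ hτ.ne', one_smul]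
  · rintro ⟨b, s⟩ hp
    obtain ⟨h1, h2, h3, h4⟩ := hp
    have hab : b = a := huniq b a h1 ha1 (hfix (b, s) h1 h2 h3 h4) hTa
    subst hab
    have h5 : (τ * s) • b = t • b := by
      have h4' : w = F b + s • b := h4
      have h6 : (1 + t) • b = (1 + τ * s) • b := by
        rw [← hy, h4']; module
      have h7 : (τ * s) • b = (1 + τ * s) • b - b := by module
      rw [h7, ← h6]; module
    have h8 : τ * s = t := by
      by_cases hb : b = 0
      · subst hb
        have hs0 : s = 0 := by simpa using h3
        have ht0 : t = 0 := by simpa using ht'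
        simp [hs0, ht0]
      · exact smul_left_injective ℝ hb h5
    rw [← h8, inv_mul_cancel_left₀ hτ.ne']

/-- A map `F` of the disk for which `id - τ F` is a contraction is injective, and half-lines
fill the complement of its image: the rays from the boundary values of `F` at the points `a` of the
unit circle, in the directions `a`. -/
theorem injOn_and_filled_of_contraction {F : ℂ → ℂ} {τ : ℝ} {κ : NNReal} (hτ : 0 < τ)
    (hκ : κ < 1) (hE : LipschitzOnWith κ (fun z => z - τ • F z) disk) :
    InjOn F disk ∧ FilledByHalfLines (F '' disk)ᶜ := by
  obtain ⟨E, hEcont, hEeq⟩ := hE.extend_finite_dimension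
  -- the continuous extension of `F` to the closed disk
  set Φ : ℂ → ℂ := fun z => τ⁻¹ • (z - E z) with hΦ
  have hΦE : ∀ z, z - τ • Φ z = E z := fun z => by
    simp only [hΦ]
    rw [smul_smul, mul_inv_cancel₀ hτ.ne', one_smul, sub_sub_cancel]
  have hΦF : ∀ z ∈ disk, Φ z = F z := fun z hz => by
    simp only [hΦ]
    rw [← hEeq hz]
    simp only [sub_sub_cancel]
    rw [smul_smul, inv_mul_cancel₀ hτ.ne', one_smul]
  have hΦcont : Continuous Φ := by
    have := hEcont.continuous
    fun_prop
  have hΦlip : LipschitzOnWith κ (fun z => z - τ • Φ z) (closedBall 0 1) := by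
    simp only [hΦE]
    rw [← closure_disk, lipschitzOnWith_closure_iff hEcont.continuous.continuousOn]
    intro x hx y hy
    rw [← hEeq hx, ← hEeq hy]
    exact hE hx hy
  have key := existsUnique_mem_normalRay hτ hκ hΦlip
  have hdisk : ∀ z, z ∈ disk ↔ ‖z‖ < 1 := fun z => by simp [disk]
  have hcompl : ∀ a : ℂ, ∀ t : ℝ, ‖a‖ = 1 → 0 ≤ t → Φ a + t • a ∉ F '' disk := by
    rintro a t ha ht ⟨z, hz, hzw⟩
    rw [hdisk] at hz
    have h := (key (Φ a + t • a)).unique (y₁ := (a, t)) (y₂ := (z, 0))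
      ⟨ha.le, ht, Or.inr ha, rfl⟩
      ⟨hz.le, le_rfl, Or.inl rfl, by simpa [hΦF z ((hdisk z).2 hz)] using hzw.symm⟩
    rw [Prod.mk.injEq] at h
    rw [← h.1, ha] at hz
    exact lt_irrefl _ hz
  refine ⟨fun x hx y hy hxy => ?_, (fun a => (Φ a, a)) '' sphere 0 1, ?_, ?_, ?_⟩
  · have h := (key (F x)).unique (y₁ := (x, 0)) (y₂ := (y, 0))
      ⟨((hdisk x).1 hx).le, le_rfl, Or.inl rfl, by simp [hΦF x hx]⟩
      ⟨((hdisk y).1 hy).le, le_rfl, Or.inl rfl, by simp [hΦF y hy, hxy]⟩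
    exact (Prod.mk.inj h).1
  · rintro _ ⟨a, ha, rfl⟩
    have ha1 : ‖a‖ = 1 := by simpa using ha
    refine ⟨ha1, ?_⟩
    rw [frontier_compl, frontier_eq_closure_inter_closure]
    constructor
    · have hacl : a ∈ closure disk := by
        rw [closure_disk]; simp [ha1]
      have h := map_mem_closure hΦcont hacl (t := F '' disk)
        fun z hz => ⟨z, hz, (hΦF z hz).symm⟩
      exact h
    · exact subset_closure (by simpa using hcompl a 0 ha1 le_rfl)
  · rintro _ ⟨a, ha, rfl⟩ _ ⟨b, hb, rfl⟩ hab
    refine Set.disjoint_left.2 fun w hwa hwb => hab ?_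
    obtain ⟨s, hs, hws⟩ := hwa
    obtain ⟨t, ht, hwt⟩ := hwb
    have ha1 : ‖a‖ = 1 := by simpa using ha
    have hb1 : ‖b‖ = 1 := by simpa using hb
    have h := (key w).unique (y₁ := (a, s)) (y₂ := (b, t))
      ⟨ha1.le, hs.le, Or.inr ha1, by simpa using hws⟩
      ⟨hb1.le, ht.le, Or.inr hb1, by simpa using hwt⟩
    rw [(Prod.mk.inj h).1]
  · ext w
    simp only [mem_iUnion, exists_prop, mem_compl_iff, exists_mem_image]
    constructor
    · rintro ⟨a, ha, t, ht, rfl⟩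
      simpa using hcompl a t (by simpa using ha) ht
    · intro hw
      obtain ⟨⟨a, t⟩, ⟨h1, h2, h3, h4⟩, -⟩ := key w
      simp only at h1 h2 h3 h4
      have ha : ‖a‖ = 1 := by
        by_contra hne
        have hlt : a ∈ disk := (hdisk a).2 (lt_of_le_of_ne h1 hne)
        have ht0 : t = 0 := h3.resolve_right hne
        exact hw ⟨a, hlt, by rw [h4, ht0, hΦF a hlt]; simp⟩
      exact ⟨a, by simpa using ha, t, h2, by simpa using h4⟩

/-! ### The derivative of `H + conj G` -/

lemma hasFDerivAt_harmonicSum {H G : ℂ → ℂ} {z : ℂ} (hH : DifferentiableAt ℂ H z)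
    (hG : DifferentiableAt ℂ G z) :
    HasFDerivAt (harmonicSum H G)
      (deriv H z • (1 : ℂ →L[ℝ] ℂ) +
        (conjCLE : ℂ →L[ℝ] ℂ).comp (deriv G z • (1 : ℂ →L[ℝ] ℂ))) z :=
  hH.hasDerivAt.complexToReal_fderiv.add
    ((conjCLE : ℂ →L[ℝ] ℂ).hasFDerivAt.comp z hG.hasDerivAt.complexToReal_fderiv)

/-- The Jacobian of `v ↦ α v + conj (β v)` is `‖α‖² - ‖β‖²`. -/
lemma det_smul_add_conj_smul (α β : ℂ) :
    (α • (1 : ℂ →L[ℝ] ℂ) + (conjCLE : ℂ →L[ℝ] ℂ).comp (β • (1 : ℂ →L[ℝ] ℂ))).det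
      = ‖α‖ ^ 2 - ‖β‖ ^ 2 := by
  rw [ContinuousLinearMap.det, ← LinearMap.det_toMatrix basisOneI, Matrix.det_fin_two]
  simp only [LinearMap.toMatrix_apply, coe_basisOneI, coe_basisOneI_repr]
  simp [← normSq_eq_norm_sq, normSq_apply]
  ring

lemma isSensePreserving_harmonicSum {H G : ℂ → ℂ} (hH : AnalyticOnNhd ℂ H disk)
    (hG : AnalyticOnNhd ℂ G disk) (h : ∀ z ∈ disk, ‖deriv G z‖ < ‖deriv H z‖) :
    IsSensePreserving (harmonicSum H G) := by
  intro z hz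
  have hd := hasFDerivAt_harmonicSum (hH z hz).differentiableAt (hG z hz).differentiableAt
  refine ⟨hd.differentiableAt, ?_⟩
  rw [hd.fderiv, det_smul_add_conj_smul, sub_pos]
  exact pow_lt_pow_left₀ (h z hz) (norm_nonneg _) two_ne_zero

lemma isHarmonicInDisk_harmonicSum {H G : ℂ → ℂ} (hH : AnalyticOnNhd ℂ H disk)
    (hG : AnalyticOnNhd ℂ G disk) : IsHarmonicInDisk (harmonicSum H G) := by
  constructor
  · intro z hz
    simpa [harmonicSum] using ((hH z hz).fun_add (hG z hz)).harmonicAt_re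
  · intro z hz
    simpa [harmonicSum, sub_eq_add_neg] using ((hH z hz).fun_sub (hG z hz)).harmonicAt_im

/-- For `M` large, `a` stays in a disk about `M` of radius less than `M`: the quantitative form of
`c ≤ re a - b` used to turn a bound on derivatives into a contraction. -/
lemma norm_sub_add_le {a : ℂ} {b c L : ℝ} (hc : 0 < c) (hb : 0 ≤ b) (haL : ‖a‖ ≤ L)
    (hre : c ≤ a.re - b) : ‖((L ^ 2 / c + L : ℝ) : ℂ) - a‖ + b ≤ (L ^ 2 / c + L) - c / 2 := by
  have hL : 0 ≤ L := (norm_nonneg a).trans haL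
  have hre' : a.re ≤ L := (re_le_norm a).trans haL
  set M := L ^ 2 / c + L with hM
  have hMc : L ^ 2 + L * c = M * c := by rw [hM]; field_simp
  have h0 : 0 ≤ M - c / 2 - b := by
    have : 0 ≤ L ^ 2 / c := by positivity
    linarith
  have hM0 : 0 ≤ M := by linarith
  rw [← le_sub_iff_add_le]
  refine le_of_sq_le_sq ?_ h0
  have h1 : ‖(M : ℂ) - a‖ ^ 2 = M ^ 2 - 2 * M * a.re + ‖a‖ ^ 2 := by
    rw [← normSq_eq_norm_sq, ← normSq_eq_norm_sq, normSq_apply, normSq_apply]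
    simp; ring
  have h2 : ‖a‖ ^ 2 ≤ L ^ 2 := pow_le_pow_left₀ (norm_nonneg _) haL 2
  have h3 : M * (c + b) ≤ M * a.re := mul_le_mul_of_nonneg_left (by linarith) hM0
  rw [h1]
  nlinarith [sq_nonneg (c / 2 + b), mul_nonneg hL hc.le]

/-- If `H'` is bounded and `re H' - |G'|` is bounded below by a positive constant, then
`id - M⁻¹ (H + conj G)` is a contraction of the disk for all large `M`. -/
lemma exists_contraction_harmonicSum {H G : ℂ → ℂ} (hH : AnalyticOnNhd ℂ H disk)
    (hG : AnalyticOnNhd ℂ G disk) {c L : ℝ} (hc : 0 < c) (hL : ∀ z ∈ disk, ‖deriv H z‖ ≤ L)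
    (hre : ∀ z ∈ disk, c ≤ (deriv H z).re - ‖deriv G z‖) :
    ∃ τ : ℝ, ∃ κ : NNReal, 0 < τ ∧ κ < 1 ∧
      LipschitzOnWith κ (fun z => z - τ • harmonicSum H G z) disk := by
  have h0 : (0 : ℂ) ∈ disk := by simp [disk]
  have hLc : c ≤ L := by
    linarith [hre 0 h0, hL 0 h0, re_le_norm (deriv H 0), norm_nonneg (deriv G 0)]
  set M := L ^ 2 / c + L with hM
  have hMc : c ≤ M := by
    have : 0 ≤ L ^ 2 / c := by positivity
    linarith
  have hMpos : 0 < M := hc.trans_le hMc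
  have hκ0 : 0 ≤ (M - c / 2) / M := div_nonneg (by linarith) hMpos.le
  refine ⟨M⁻¹, ((M - c / 2) / M).toNNReal, inv_pos.2 hMpos, ?_, ?_⟩
  · rw [Real.toNNReal_lt_one, div_lt_one hMpos]
    linarith
  · refine (convex_ball (0 : ℂ) 1).lipschitzOnWith_of_nnnorm_hasFDerivWithin_le (𝕜 := ℝ)
      (f' := fun z => ContinuousLinearMap.id ℝ ℂ - M⁻¹ • (deriv H z • (1 : ℂ →L[ℝ] ℂ) +
        (conjCLE : ℂ →L[ℝ] ℂ).comp (deriv G z • (1 : ℂ →L[ℝ] ℂ)))) (fun z hz => ?_) (fun z hz => ?_)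
    · exact ((hasFDerivAt_id z).sub ((hasFDerivAt_harmonicSum (hH z hz).differentiableAt
        (hG z hz).differentiableAt).const_smul M⁻¹)).hasFDerivWithinAt
    · rw [← NNReal.coe_le_coe, coe_nnnorm, Real.coe_toNNReal _ hκ0]
      refine ContinuousLinearMap.opNorm_le_bound _ hκ0 fun v => ?_
      have hM' : (M : ℂ) ≠ 0 := by exact_mod_cast hMpos.ne'
      have h1 : (ContinuousLinearMap.id ℝ ℂ - M⁻¹ • (deriv H z • (1 : ℂ →L[ℝ] ℂ) +
          (conjCLE : ℂ →L[ℝ] ℂ).comp (deriv G z • (1 : ℂ →L[ℝ] ℂ)))) v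
          = (M : ℂ)⁻¹ * (((M : ℂ) - deriv H z) * v - conj (deriv G z * v)) := by
        simp
        field_simp
        ring
      rw [h1, norm_mul, norm_inv, norm_real, Real.norm_of_nonneg hMpos.le, div_eq_inv_mul,
        mul_assoc]
      refine mul_le_mul_of_nonneg_left ?_ (inv_nonneg.2 hMpos.le)
      refine (norm_sub_le _ _).trans ?_
      rw [norm_conj, norm_mul, norm_mul, ← add_mul]
      exact mul_le_mul_of_nonneg_right
        (norm_sub_add_le hc (norm_nonneg _) (hL z hz) (hre z hz)) (norm_nonneg _)

/-! ### The class `𝒰₂(λ)` -/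

lemma isOpen_disk : IsOpen disk := isOpen_ball

lemma ne_zero_of_mem_ClassU {lam : ℝ} (hlam : lam ≤ 1) {f : ℂ → ℂ} (hf : f ∈ ClassU lam) {z : ℂ}
    (hz : z ∈ disk) (hz0 : z ≠ 0) : f z ≠ 0 := by
  intro h
  have := hf.2 z hz
  simp only [opU, zDiv, hz0, h, if_false, div_zero] at this
  norm_num at this
  linarith

lemma zDiv_eq_inv_dslope {f : ℂ → ℂ} (hf : f ∈ ClassA) (z : ℂ) : zDiv f z = (dslope f 0 z)⁻¹ := by
  by_cases hz : z = 0
  · subst hz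
    simp [zDiv, hf.2.2]
  · simp [zDiv, hz, dslope_of_ne, slope_def_field, hf.2.1]

lemma mul_zDiv {lam : ℝ} (hlam : lam ≤ 1) {f : ℂ → ℂ} (hf : f ∈ ClassU lam) {z : ℂ}
    (hz : z ∈ disk) : f z * zDiv f z = z := by
  by_cases hz0 : z = 0
  · simp [hz0, hf.1.2.1]
  · simp only [zDiv, hz0, if_false]
    exact mul_div_cancel₀ _ (ne_zero_of_mem_ClassU hlam hf hz hz0)

lemma differentiableOn_zDiv {lam : ℝ} (hlam : lam ≤ 1) {f : ℂ → ℂ} (hf : f ∈ ClassU lam) :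
    DifferentiableOn ℂ (zDiv f) disk := by
  have h0 : disk ∈ nhds (0 : ℂ) := ball_mem_nhds _ one_pos
  have h1 := (Complex.differentiableOn_dslope h0).2 hf.1.1.differentiableOn
  refine (h1.inv fun z hz => ?_).congr fun z _ => zDiv_eq_inv_dslope hf.1 z
  by_cases hz0 : z = 0
  · subst hz0
    simp [hf.1.2.2]
  · have := ne_zero_of_mem_ClassU hlam hf hz hz0
    simp [dslope_of_ne, slope_def_field, hf.1.2.1, hz0, this]

/-- Differentiating `f p = z` for `p = z / f`. -/
lemma deriv_mul_zDiv_add {lam : ℝ} (hlam : lam ≤ 1) {f : ℂ → ℂ} (hf : f ∈ ClassU lam) {z : ℂ}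
    (hz : z ∈ disk) : deriv f z * zDiv f z + f z * deriv (zDiv f) z = 1 := by
  have hp := (differentiableOn_zDiv hlam hf).differentiableAt (isOpen_disk.mem_nhds hz)
  have h : (fun w => f w * zDiv f w) =ᶠ[nhds z] id := by
    filter_upwards [isOpen_disk.mem_nhds hz] with w hw using mul_zDiv hlam hf hw
  rw [← deriv_fun_mul (hf.1.1 z hz).differentiableAt hp, h.deriv_eq, deriv_id]

/-- The operator `U_f` is linear in `p = z / f`. -/
lemma opU_eq {lam : ℝ} (hlam : lam ≤ 1) {f : ℂ → ℂ} (hf : f ∈ ClassU lam) {z : ℂ}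
    (hz : z ∈ disk) : opU f z = zDiv f z - z * deriv (zDiv f) z - 1 := by
  have h1 := deriv_mul_zDiv_add hlam hf hz
  have h2 := mul_zDiv hlam hf hz
  rw [opU]
  linear_combination zDiv f z * h1 - deriv (zDiv f) z * h2

lemma deriv_zDiv_zero {lam : ℝ} (hlam : lam ≤ 1) {f : ℂ → ℂ} (hf : f ∈ ClassU₂ lam) :
    deriv (zDiv f) 0 = 0 := by
  have h0 : (0 : ℂ) ∈ disk := by simp [disk]
  have hn := isOpen_disk.mem_nhds h0
  have hp := differentiableOn_zDiv hlam hf.1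
  have hf' : DifferentiableAt ℂ (deriv f) 0 := (hf.1.1.1 0 h0).deriv.differentiableAt
  have hp' : DifferentiableAt ℂ (deriv (zDiv f)) 0 :=
    (hp.analyticAt hn).deriv.differentiableAt
  have hfd := (hf.1.1.1 0 h0).differentiableAt
  have hpd := hp.differentiableAt hn
  have h : (fun w => deriv f w * zDiv f w + f w * deriv (zDiv f) w) =ᶠ[nhds 0] fun _ => 1 := by
    filter_upwards [hn] with w hw using deriv_mul_zDiv_add hlam hf.1 hw
  have h1 := h.deriv_eq
  have h2 : deriv (deriv f) 0 = 0 := by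
    have := hf.2
    rwa [iteratedDeriv_succ, iteratedDeriv_one] at this
  rw [deriv_fun_add (hf'.fun_mul hpd) (hfd.fun_mul hp'), deriv_fun_mul hf' hpd, deriv_fun_mul hfd hp',
    deriv_const, h2, hf.1.1.2.1, hf.1.1.2.2] at h1
  linear_combination h1 / 2

/-- For `f ∈ 𝒰₂(λ)` the function `p = z / f` satisfies `|p - 1| ≤ λ`: the quotient
`q = (p - 1) / z` vanishes at the origin, and `q' = - U_f / z ^ 2` is bounded by `λ` by the maximum
principle. -/
lemma norm_zDiv_sub_one_le {lam : ℝ} (hlam_pos : 0 < lam) (hlam : lam ≤ 1) {f : ℂ → ℂ}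
    (hf : f ∈ ClassU₂ lam) {z : ℂ} (hz : z ∈ disk) : ‖zDiv f z - 1‖ ≤ lam := by
  have h0 : (0 : ℂ) ∈ disk := by simp [disk]
  have hp := differentiableOn_zDiv hlam hf.1
  have hp0 : zDiv f 0 = 1 := by simp [zDiv]
  set q := dslope (zDiv f) 0 with hq
  have hqd : DifferentiableOn ℂ q disk :=
    (Complex.differentiableOn_dslope (isOpen_disk.mem_nhds h0)).2 hp
  have hq0 : q 0 = 0 := by rw [hq, dslope_same, deriv_zDiv_zero hlam hf]
  have hqp : ∀ w, w * q w = zDiv f w - 1 := fun w => by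
    simpa [hp0] using sub_smul_dslope (zDiv f) 0 w
  have hq' : ∀ w ∈ disk, w ^ 2 * deriv q w = - opU f w := fun w hw => by
    have hqw := hqd.differentiableAt (isOpen_disk.mem_nhds hw)
    have h1 : zDiv f = fun w => w * q w + 1 := funext fun w => by rw [hqp]; ring
    have h2 : deriv (zDiv f) w = q w + w * deriv q w := by
      have h3 := (((hasDerivAt_id w).mul hqw.hasDerivAt).add_const 1).deriv
      rw [h1]
      simpa using h3
    rw [opU_eq hlam hf.1 hw, h2]
    linear_combination -hqp w
  have hq'd : DifferentiableOn ℂ (deriv q) disk := hqd.deriv isOpen_disk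
  have hbound_r : ∀ w ∈ disk, ∀ r : ℝ, ‖w‖ < r → r < 1 → r ^ 2 * ‖deriv q w‖ ≤ lam := by
    intro w _ r hwr hr
    have hr0 : 0 < r := (norm_nonneg w).trans_lt hwr
    have hsub : closedBall (0 : ℂ) r ⊆ disk := closedBall_subset_ball hr
    have hcl : closure (ball (0 : ℂ) r) = closedBall 0 r := closure_ball _ hr0.ne'
    rw [mul_comm, ← le_div_iff₀ (by positivity)]
    refine Complex.norm_le_of_forall_mem_frontier_norm_le (U := ball (0 : ℂ) r) isBounded_ball
      (hq'd.mono (hcl ▸ hsub)).diffContOnCl (fun u hu => ?_) (subset_closure (by simpa using hwr))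
    rw [frontier_ball _ hr0.ne'] at hu
    have hu' := hsub (sphere_subset_closedBall hu)
    have h1 := congrArg norm (hq' u hu')
    rw [norm_mul, norm_pow, norm_neg, mem_sphere_zero_iff_norm.1 hu] at h1
    rw [le_div_iff₀ (by positivity), mul_comm, h1]
    exact (hf.1.2 u hu').le
  have hbound : ∀ w ∈ disk, ‖deriv q w‖ ≤ lam := by
    intro w hw
    have hw1 : ‖w‖ < 1 := by simpa [disk] using hw
    have ht : Filter.Tendsto (fun r : ℝ => r ^ 2 * ‖deriv q w‖) (nhdsWithin 1 (Iio 1))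
        (nhds (1 ^ 2 * ‖deriv q w‖)) :=
      ((continuous_id.pow 2).mul continuous_const).continuousAt.tendsto.mono_left
        nhdsWithin_le_nhds
    have := le_of_tendsto ht (by
      filter_upwards [Ioo_mem_nhdsLT hw1] with r hr using hbound_r w hw r hr.1 hr.2)
    simpa using this
  have hz1 : ‖z‖ < 1 := by simpa [disk] using hz
  have h1 := (convex_ball (0 : ℂ) 1).norm_image_sub_le_of_norm_deriv_le (𝕜 := ℂ) (f := q)
    (fun w hw => hqd.differentiableAt (isOpen_disk.mem_nhds hw)) hbound h0 hz
  rw [hq0, sub_zero, sub_zero] at h1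
  rw [← hqp, norm_mul]
  nlinarith [norm_nonneg z, norm_nonneg (q z), mul_le_mul hz1.le h1 (norm_nonneg _) zero_le_one]

/-! ### Estimates for the argument -/

/-- A point `x` with `|x - 1| ≤ s` satisfies `|arg x| ≤ arcsin s`. The sine bound is kept
exactly; the cosine bound `√(1 - s ^ 2)` is weakened to the polynomial `1 - s ^ 2`. -/
lemma re_im_bounds_of_norm_sub_one_le {s : ℝ} (hs1 : s ≤ 1) {x : ℂ} (hx : ‖x - 1‖ ≤ s) :
    (1 - s ^ 2) * ‖x‖ ≤ x.re ∧ |x.im| ≤ s * ‖x‖ := by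
  have hs : 0 ≤ s := (norm_nonneg _).trans hx
  have h1 : ‖x - 1‖ ^ 2 ≤ s ^ 2 := pow_le_pow_left₀ (norm_nonneg _) hx 2
  have h2 : ‖x - 1‖ ^ 2 = ‖x‖ ^ 2 - 2 * x.re + 1 := by
    rw [← normSq_eq_norm_sq, ← normSq_eq_norm_sq, normSq_apply, normSq_apply]
    simp; ring
  have h3 : ‖x‖ ^ 2 = x.re ^ 2 + x.im ^ 2 := by
    rw [← normSq_eq_norm_sq, normSq_apply]; ring
  have hs2 : 0 ≤ 1 - s ^ 2 := by nlinarith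
  have hre : 0 ≤ x.re := by nlinarith [sq_nonneg ‖x‖]
  -- `(|x|² + 1 - s²)² ≥ 4 |x|² (1 - s²)` by the arithmetic-geometric mean inequality
  have h4 : (1 - s ^ 2) * ‖x‖ ^ 2 ≤ x.re ^ 2 := by
    have h5 : ‖x‖ ^ 2 + (1 - s ^ 2) ≤ 2 * x.re := by linarith
    have h6 := pow_le_pow_left₀ (by positivity) h5 2
    nlinarith [sq_nonneg (‖x‖ ^ 2 - (1 - s ^ 2))]
  constructor
  · refine le_of_sq_le_sq ?_ hre
    rw [mul_pow]
    nlinarith [mul_nonneg (mul_nonneg hs2 (sq_nonneg s)) (sq_nonneg ‖x‖)]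
  · refine abs_le_of_sq_le_sq ?_ (by positivity)
    rw [mul_pow]
    linarith

/-- A lower bound for `cos (arg (x / y ^ 2))`, where `x` and `y` lie in the disk of radius `s`
about `1`; the sharp bound is `cos (3 arcsin s)`. -/
lemma le_re_div_sq {s : ℝ} (hs1 : s ≤ 1 / 2) {x y : ℂ} (hx : ‖x - 1‖ ≤ s) (hy : ‖y - 1‖ ≤ s) :
    (1 - 5 * s ^ 2 + 2 * s ^ 4) * ‖x / y ^ 2‖ ≤ (x / y ^ 2).re := by
  have hs : 0 ≤ s := (norm_nonneg _).trans hx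
  obtain ⟨hx1, hx2⟩ := re_im_bounds_of_norm_sub_one_le (by linarith) hx
  obtain ⟨-, hy2⟩ := re_im_bounds_of_norm_sub_one_le (by linarith) hy
  have hy0 : y ≠ 0 := by
    rintro rfl
    norm_num at hy
    linarith
  have hyn : 0 < ‖y‖ := norm_pos_iff.2 hy0
  have hysq : ‖y‖ ^ 2 = y.re ^ 2 + y.im ^ 2 := by
    rw [← normSq_eq_norm_sq, normSq_apply]; ring
  have h1 : x / y ^ 2 = ((‖y‖ ^ 4 : ℝ) : ℂ)⁻¹ * (x * conj y ^ 2) := by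
    have h2 : y * conj y = ((‖y‖ ^ 2 : ℝ) : ℂ) := by
      rw [mul_conj, normSq_eq_norm_sq]
    have h3 : ((‖y‖ ^ 4 : ℝ) : ℂ) = y ^ 2 * conj y ^ 2 := by
      rw [← mul_pow, h2]; push_cast; ring
    have h4 : conj y ≠ 0 := (map_ne_zero _).2 hy0
    rw [h3]
    field_simp
  have h5 : (x * conj y ^ 2).re
      = x.re * (y.re ^ 2 - y.im ^ 2) + 2 * (x.im * (y.re * y.im)) := by
    simp [pow_two]; ring
  have h6 : (x / y ^ 2).re = (‖y‖ ^ 4)⁻¹ * (x * conj y ^ 2).re := by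
    rw [h1, ← ofReal_inv, re_ofReal_mul]
  rw [h6, h5, norm_div, norm_pow]
  have h7 : (1 - 5 * s ^ 2 + 2 * s ^ 4) * (‖x‖ / ‖y‖ ^ 2)
      = (‖y‖ ^ 4)⁻¹ * ((1 - 5 * s ^ 2 + 2 * s ^ 4) * (‖x‖ * ‖y‖ ^ 2)) := by
    field_simp
  rw [h7]
  refine mul_le_mul_of_nonneg_left ?_ (by positivity)
  have h8 : y.im ^ 2 ≤ s ^ 2 * ‖y‖ ^ 2 := by
    rw [← mul_pow, ← sq_abs y.im]
    exact pow_le_pow_left₀ (abs_nonneg _) hy2 2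
  have h9 : (1 - 2 * s ^ 2) * ‖y‖ ^ 2 ≤ y.re ^ 2 - y.im ^ 2 := by linarith
  have h10 : ((1 - s ^ 2) * ‖x‖) * ((1 - 2 * s ^ 2) * ‖y‖ ^ 2)
      ≤ x.re * (y.re ^ 2 - y.im ^ 2) := by
    refine mul_le_mul hx1 h9 (by have : 0 ≤ 1 - 2 * s ^ 2 := by nlinarith
                                 positivity) ?_
    refine le_trans (mul_nonneg ?_ (norm_nonneg _)) hx1
    nlinarith
  have h11 : |x.im * (y.re * y.im)| ≤ (s * ‖x‖) * (‖y‖ * (s * ‖y‖)) := by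
    rw [abs_mul, abs_mul]
    gcongr
    exact abs_re_le_norm y
  nlinarith [(abs_le.1 h11).1]

/-- The hypothesis on `λ` and the bound on the dilatation leave room: the cosine bound exceeds the
bound on the dilatation. -/
lemma dilatation_bound_lt {s : ℝ} (hs : 0 < s) (hs1 : s ≤ Real.sqrt 2 - 1) :
    (1 - 2 * s - s ^ 2) / (1 + s) ^ 2 < 1 - 5 * s ^ 2 + 2 * s ^ 4 := by
  have h2 : s ≤ 0.415 := by
    have : Real.sqrt 2 ≤ 1.415 := Real.sqrt_le_iff.2 ⟨by norm_num, by norm_num⟩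
    linarith
  rw [div_lt_iff₀ (by positivity)]
  have h3 : 0 < 4 - 3 * s - 10 * s ^ 2 - 3 * s ^ 3 := by
    have h4 : s ^ 2 ≤ 0.415 ^ 2 := pow_le_pow_left₀ hs.le h2 2
    have h5 : s ^ 3 ≤ 0.415 ^ 3 := pow_le_pow_left₀ hs.le h2 3
    norm_num at h4 h5
    linarith
  nlinarith [mul_pos hs h3, pow_pos hs 5, pow_pos hs 6]

end HarmonicUnivalent

/-! ### Sense-preservation and close-to-convexity of `H + conj G` -/

open HarmonicUnivalent in
theorem theorem5 (lam : ℝ) (hlam_pos : 0 < lam) (hlam_le : lam ≤ Real.sqrt 2 - 1)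
    (H G : ℂ → ℂ) (hH : H ∈ HarmonicUnivalent.ClassU₂ lam)
    (hG : AnalyticOnNhd ℂ G HarmonicUnivalent.disk)
    (hω_zero : HarmonicUnivalent.dilatation H G 0 = 0)
    (hω_bound : ∀ z ∈ HarmonicUnivalent.disk,
      ‖HarmonicUnivalent.dilatation H G z‖ ≤ (1 - 2 * lam - lam ^ 2) / (1 + lam) ^ 2) :
    HarmonicUnivalent.IsSensePreserving (HarmonicUnivalent.harmonicSum H G) ∧
      HarmonicUnivalent.IsCloseToConvexHarmonic (HarmonicUnivalent.harmonicSum H G) := by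
  have hhalf : lam ≤ 1 / 2 := by
    have : Real.sqrt 2 ≤ 1.5 := Real.sqrt_le_iff.2 ⟨by norm_num, by norm_num⟩
    linarith
  have hlam1 : lam ≤ 1 := by linarith
  have hHan := hH.1.1.1
  set k := (1 - 2 * lam - lam ^ 2) / (1 + lam) ^ 2 with hk
  set m := 1 - 5 * lam ^ 2 + 2 * lam ^ 4 with hm
  have hkm : k < m := dilatation_bound_lt hlam_pos hlam_le
  have hpb : ∀ z ∈ disk, ‖zDiv H z - 1‖ ≤ lam := fun z hz =>
    norm_zDiv_sub_one_le hlam_pos hlam1 hH hz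
  have hxb : ∀ z ∈ disk, ‖(1 + opU H z) - 1‖ ≤ lam := fun z hz => by
    simpa using (hH.1.2 z hz).le
  have hmem : ∀ {x : ℂ}, ‖x - 1‖ ≤ lam → 1 - lam ≤ ‖x‖ ∧ ‖x‖ ≤ 1 + lam := fun {x} hx => by
    have h1 := abs_norm_sub_norm_le x 1
    rw [norm_one] at h1
    have h2 := abs_le.1 (h1.trans hx)
    constructor <;> linarith
  have hH' : ∀ z ∈ disk, deriv H z = (1 + opU H z) / zDiv H z ^ 2 := fun z hz => by
    have h1 : zDiv H z ≠ 0 := norm_pos_iff.1 (by linarith [(hmem (hpb z hz)).1])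
    rw [opU]
    field_simp
    ring
  have hlower : ∀ z ∈ disk, (1 - lam) / (1 + lam) ^ 2 ≤ ‖deriv H z‖ := fun z hz => by
    obtain ⟨h1, h2⟩ := hmem (hpb z hz)
    obtain ⟨h3, h4⟩ := hmem (hxb z hz)
    have h5 : 0 < ‖zDiv H z‖ := by linarith
    rw [hH' z hz, norm_div, norm_pow]
    gcongr
  have hupper : ∀ z ∈ disk, ‖deriv H z‖ ≤ (1 + lam) / (1 - lam) ^ 2 := fun z hz => by
    obtain ⟨h1, h2⟩ := hmem (hpb z hz)
    obtain ⟨h3, h4⟩ := hmem (hxb z hz)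
    have h5 : 0 < 1 - lam := by linarith
    rw [hH' z hz, norm_div, norm_pow]
    gcongr
  have hpos : 0 < (1 - lam) / (1 + lam) ^ 2 := div_pos (by linarith) (by positivity)
  have hre : ∀ z ∈ disk, m * ‖deriv H z‖ ≤ (deriv H z).re := fun z hz => by
    rw [hH' z hz]
    exact le_re_div_sq hhalf (hxb z hz) (hpb z hz)
  have hG' : ∀ z ∈ disk, ‖deriv G z‖ ≤ k * ‖deriv H z‖ := fun z hz => by
    have h1 := hω_bound z hz
    rwa [dilatation, norm_div, div_le_iff₀ (hpos.trans_le (hlower z hz))] at h1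
  have hgap : ∀ z ∈ disk, (m - k) * ((1 - lam) / (1 + lam) ^ 2)
      ≤ (deriv H z).re - ‖deriv G z‖ := fun z hz => by
    have h1 := mul_le_mul_of_nonneg_left (hlower z hz) (sub_nonneg.2 hkm.le)
    linarith [hre z hz, hG' z hz]
  have hc := mul_pos (sub_pos.2 hkm) hpos
  obtain ⟨τ, κ, hτ, hκ, hlip⟩ := exists_contraction_harmonicSum hHan hG hc hupper hgap
  obtain ⟨hinj, hfill⟩ := injOn_and_filled_of_contraction hτ hκ hlip
  refine ⟨isSensePreserving_harmonicSum hHan hG fun z hz => ?_,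
    isHarmonicInDisk_harmonicSum hHan hG, hinj, hfill⟩
  linarith [hgap z hz, re_le_norm (deriv H z)]
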